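/- Let $\mathcal O$ be a complete discrete valuation ring with maximal ideal $\pi\mathcal O$, $\pi\neq 0$. Let $A$ be an $\mathcal O$-algebra which is free of finite rank as an $\mathcal O$-module, let $r$ be a positive integer, and put $A^e=A\otimes_{\mathcal O}A^{\mathrm{op}}$ and $\bar A=A/\pi^rA$. Let $P$ be a projective resolution of $A$ as an $A^e$-module, with differentials $\epsilon_n:P_n\to P_{n-1}$. Identify, for every $n\ge 0$, the Hochschild cohomology $HH^n(\bar A)\cong HH^n(A;\bar A)$ with $H^n(\mathrm{Hom}_{A^e}(P,\bar A))$, where the differential of $\mathrm{Hom}_{A^e}(P,-)$ is $f\mapsto f\circ\epsilon$. Let $h:P\to P\otimes_AP$ be a chain map of complexes of $A^e$-modules which lifts the identity on $A\cong A\otimes_AA$; here the differential of $P\otimes_AP$ is $\epsilon_i\otimes\mathrm{Id}+(-1)^i\,\mathrm{Id}\otimes\epsilon_j$ on $P_i\otimes_AP_j$ (such an $h$ exists and is unique up to homotopy). The cup product $\zeta\eta\in HH^{m+n}(\bar A)$ of $\zeta\in HH^m(\bar A)$ and $\eta\in HH^n(\bar A)$ is the class of the cocycle $(f\otimes g)\circ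 h_{m+n}$, where $f:P_m\to\bar A$ and $g:P_n\to\bar A$ are cocycles representing $\zeta$ and $\eta$, and $f\otimes g:P_m\otimes_AP_n\to\bar A$ is the map $x\otimes y\mapsto f(x)g(y)$, extended by $0$ to the other summands of $(P\otimes_AP)_{m+n}$. For every $n\ge 0$ let $\beta_n:HH^n(\bar A)\to HH^{n+1}(\bar A)$ be the connecting homomorphism in the long exact cohomology sequence of the short exact sequence of cochain complexes $$0\to\mathrm{Hom}_{A^e}(P,\bar A)\to\mathrm{Hom}_{A^e}(P,A/\pi^{2r}A)\to\mathrm{Hom}_{A^e}(P,\bar A)\to 0$$ induced by the exact sequence $0\to\bar A\xrightarrow{\ \pi^r\ }A/\pi^{2r}A\to\bar A\to 0$ of $A^e$-modules. Then for all integers $m,n\ge 0$, all $\zeta\in HH^m(\bar A)$ and all $\eta\in HH^n(\bar A)$, $$\beta_{m+n}(\zeta\eta)=\beta_m(\zeta)\,\eta+(-1)^m\,\zeta\,\beta_n(\eta).$$ -/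

import Mathlib

open CategoryTheory TensorProduct MulOpposite

universe u v

noncomputable section

namespace HochschildBockstein

/-- The enveloping algebra `Aᵉ = A ⊗[O] Aᵒᵖ`; its left modules are the `A`-`A`-bimodules on which
the two actions of `O` agree. -/
abbrev Env (O : Type u) (A : Type v) [CommRing O] [Ring A] [Algebra O A] : Type v :=
  A ⊗[O] Aᵐᵒᵖ

section Bimodules

variable {O : Type u} {A : Type v} [CommRing O] [Ring A] [Algebra O A]

/-- An algebra `B` regarded as an `A`-`A`-bimodule through an algebra homomorphism `φ : A → B`:
`(a ⊗ b) • x = φ a * x * φ b`. -/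
def AlgBimod {B : Type v} [Ring B] [Algebra O B] (_φ : A →ₐ[O] B) : Type v := B

section AlgBimod

variable {B : Type v} [Ring B] [Algebra O B] (φ : A →ₐ[O] B)

instance : Ring (AlgBimod φ) := inferInstanceAs (Ring B)
instance : Algebra O (AlgBimod φ) := inferInstanceAs (Algebra O B)

/-- The action of the enveloping algebra on `AlgBimod φ`. -/
def envAct : Env O A →ₐ[O] Module.End O (AlgBimod φ) :=
  (AlgHom.mulLeftRight O B).comp (Algebra.TensorProduct.map φ (AlgHom.op φ))

instance : Module (Env O A) (AlgBimod φ) := Module.compHom (AlgBimod φ) (envAct φ).toRingHom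

lemma AlgBimod.tmul_smul (a b : A) (x : AlgBimod φ) :
    (a ⊗ₜ[O] op b : Env O A) • x = @HMul.hMul B B B _ (@HMul.hMul B B B _ (φ a) x) (φ b) :=
  (AlgHom.mulLeftRight_apply O B (φ a) (op (φ b)) x)

lemma AlgBimod.smul_def (e : Env O A) (x : AlgBimod φ) : e • x = envAct φ e x := rfl

instance : IsScalarTower O (Env O A) (AlgBimod φ) where
  smul_assoc c e x := by simp [AlgBimod.smul_def]

end AlgBimod

variable (O A) in
/-- The regular bimodule: `A` as a module over its enveloping algebra. -/
def regular : ModuleCat.{v} (Env O A) := ModuleCat.of (Env O A) (AlgBimod (AlgHom.id O A))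

/-- A bimodule is in particular an `O`-module. -/
instance instModuleBase (X : ModuleCat.{v} (Env O A)) : Module O X :=
  Module.restrictScalars O (Env O A) X

instance (X : ModuleCat.{v} (Env O A)) : IsScalarTower O (Env O A) X :=
  IsScalarTower.restrictScalars O (Env O A) X

/-- The submodule of `X ⊗[O] Y` spanned by all `x a ⊗ y - x ⊗ a y`. -/
def balancing (X Y : ModuleCat.{v} (Env O A)) : Submodule O (X ⊗[O] Y) :=
  Submodule.span O {t | ∃ (x : X) (a : A) (y : Y),
    t = (((1 : A) ⊗ₜ[O] op a : Env O A) • x) ⊗ₜ[O] y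
      - x ⊗ₜ[O] ((a ⊗ₜ[O] (1 : Aᵐᵒᵖ) : Env O A) • y)}

/-- The tensor product `X ⊗_A Y` of two `A`-`A`-bimodules: the quotient of `X ⊗[O] Y` by the
relations `x a ⊗ y = x ⊗ a y`. -/
def BalTensor (X Y : ModuleCat.{v} (Env O A)) : Type v := (X ⊗[O] Y) ⧸ balancing X Y

namespace BalTensor

variable (X Y : ModuleCat.{v} (Env O A))

instance : AddCommGroup (BalTensor X Y) := inferInstanceAs (AddCommGroup (_ ⧸ balancing X Y))
instance : Module O (BalTensor X Y) := inferInstanceAs (Module O (_ ⧸ balancing X Y))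

variable {X Y}

variable (X Y) in
/-- The canonical bilinear map `X × Y → X ⊗_A Y`. -/
def mk : X →ₗ[O] Y →ₗ[O] BalTensor X Y :=
  LinearMap.compr₂ (TensorProduct.mk O X Y) (balancing X Y).mkQ

/-- The class `x ⊗_A y`. -/
def tmul (x : X) (y : Y) : BalTensor X Y := mk X Y x y

lemma balanced (x : X) (a : A) (y : Y) :
    tmul (((1 : A) ⊗ₜ[O] op a : Env O A) • x) y = tmul x ((a ⊗ₜ[O] (1 : Aᵐᵒᵖ) : Env O A) • y) :=
  (Submodule.Quotient.eq _).2 (Submodule.subset_span ⟨x, a, y, rfl⟩)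

lemma tmul_add (x : X) (y y' : Y) : tmul x (y + y') = tmul x y + tmul x y' :=
  map_add (mk X Y x) y y'

lemma add_tmul (x x' : X) (y : Y) : tmul (x + x') y = tmul x y + tmul x' y :=
  (mk X Y).map_add₂ x x' y

lemma smul_tmul (c : O) (x : X) (y : Y) : tmul (c • x) y = c • tmul x y :=
  (mk X Y).map_smul₂ c x y

lemma tmul_smul (c : O) (x : X) (y : Y) : tmul x (c • y) = c • tmul x y :=
  map_smul (mk X Y x) c y

lemma induction {p : BalTensor X Y → Prop} (h0 : p 0) (ht : ∀ x y, p (tmul x y))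
    (ha : ∀ s t, p s → p t → p (s + t)) (t : BalTensor X Y) : p t := by
  obtain ⟨t, rfl⟩ := (balancing X Y).mkQ_surjective t
  induction t using TensorProduct.induction_on with
  | zero => rw [map_zero]; exact h0
  | tmul x y => exact ht x y
  | add s t hs ht => rw [map_add]; exact ha _ _ hs ht

/-- The linear map out of `X ⊗_A Y` induced by a balanced bilinear map. -/
def lift {Z : Type v} [AddCommGroup Z] [Module O Z] (f : X →ₗ[O] Y →ₗ[O] Z)
    (hf : ∀ x (a : A) y, f (((1 : A) ⊗ₜ[O] op a : Env O A) • x) y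
      = f x ((a ⊗ₜ[O] (1 : Aᵐᵒᵖ) : Env O A) • y)) : BalTensor X Y →ₗ[O] Z :=
  (balancing X Y).liftQ (TensorProduct.lift f) (by
    refine Submodule.span_le.2 ?_
    rintro _ ⟨x, a, y, rfl⟩
    simp [hf])

@[simp] lemma lift_tmul {Z : Type v} [AddCommGroup Z] [Module O Z] (f : X →ₗ[O] Y →ₗ[O] Z)
    (hf) (x : X) (y : Y) : lift f hf (tmul x y) = f x y :=
  TensorProduct.lift.tmul x y

lemma hom_ext {Z : Type v} [AddCommGroup Z] [Module O Z] {f g : BalTensor X Y →ₗ[O] Z}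
    (h : ∀ x y, f (tmul x y) = g (tmul x y)) : f = g := by
  ext t
  induction t using BalTensor.induction with
  | h0 => simp
  | ht x y => exact h x y
  | ha s t hs ht => simp [hs, ht]

/-- `f ⊗ g` on `X ⊗_A Y`, where `f` respects the right and `g` the left action of `A`. -/
def map {X' Y' : ModuleCat.{v} (Env O A)} (f : X →ₗ[O] X') (g : Y →ₗ[O] Y')
    (hf : ∀ (a : A) x, f (((1 : A) ⊗ₜ[O] op a : Env O A) • x)
      = ((1 : A) ⊗ₜ[O] op a : Env O A) • f x)
    (hg : ∀ (a : A) y, g ((a ⊗ₜ[O] (1 : Aᵐᵒᵖ) : Env O A) • y)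
      = (a ⊗ₜ[O] (1 : Aᵐᵒᵖ) : Env O A) • g y) : BalTensor X Y →ₗ[O] BalTensor X' Y' :=
  lift (LinearMap.mk₂ O (fun x y => tmul (f x) (g y))
    (fun _ _ _ => by rw [map_add, add_tmul]) (fun _ _ _ => by rw [map_smul, smul_tmul])
    (fun _ _ _ => by rw [map_add, tmul_add]) (fun _ _ _ => by rw [map_smul, tmul_smul]))
    (fun x a y => by simp [hf, hg, balanced])

@[simp] lemma map_tmul {X' Y' : ModuleCat.{v} (Env O A)} (f : X →ₗ[O] X') (g : Y →ₗ[O] Y')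
    (hf hg) (x : X) (y : Y) : map f g hf hg (tmul x y) = tmul (f x) (g y) := by
  simp [map]

/-- Multiplication by an element of the enveloping algebra, as an `O`-algebra homomorphism. -/
abbrev act (X : ModuleCat.{v} (Env O A)) : Env O A →ₐ[O] Module.End O X :=
  Algebra.lsmul O O X

/-- The left action of `A` on `X ⊗_A Y`: `a (x ⊗ y) = a x ⊗ y`. -/
def leftAct (X Y : ModuleCat.{v} (Env O A)) : A →ₐ[O] Module.End O (BalTensor X Y) :=
  AlgHom.ofLinearMap
    { toFun := fun a => map (act X (a ⊗ₜ[O] 1)) LinearMap.id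
        (fun b x => by simp [← mul_smul]) (fun _ _ => rfl)
      map_add' := fun a b => hom_ext fun x y => by
        simp [TensorProduct.add_tmul, add_tmul]
      map_smul' := fun c a => hom_ext fun x y => by
        simp [← TensorProduct.smul_tmul', smul_tmul] }
    (hom_ext fun x y => by simp [← Algebra.TensorProduct.one_def])
    (fun a b => hom_ext fun x y => by simp [← mul_smul])

/-- The right action of `A` on `X ⊗_A Y`: `(x ⊗ y) a = x ⊗ y a`. -/
def rightAct (X Y : ModuleCat.{v} (Env O A)) : Aᵐᵒᵖ →ₐ[O] Module.End O (BalTensor X Y) :=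
  AlgHom.ofLinearMap
    { toFun := fun b => map LinearMap.id (act Y (1 ⊗ₜ[O] b))
        (fun _ _ => rfl) (fun b x => by simp [← mul_smul])
      map_add' := fun a b => hom_ext fun x y => by
        simp [TensorProduct.tmul_add, tmul_add]
      map_smul' := fun c a => hom_ext fun x y => by
        simp [TensorProduct.tmul_smul, tmul_smul] }
    (hom_ext fun x y => by simp [← Algebra.TensorProduct.one_def])
    (fun a b => hom_ext fun x y => by simp [← mul_smul])

/-- The action of the enveloping algebra on `X ⊗_A Y`: `(a ⊗ b) • (x ⊗ y) = a x ⊗ y b`. -/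
def envAct (X Y : ModuleCat.{v} (Env O A)) : Env O A →ₐ[O] Module.End O (BalTensor X Y) :=
  Algebra.TensorProduct.lift (leftAct X Y) (rightAct X Y) fun a b =>
    hom_ext fun x y => by simp [leftAct, rightAct]

instance : Module (Env O A) (BalTensor X Y) :=
  Module.compHom (BalTensor X Y) (envAct X Y).toRingHom

lemma smul_def (e : Env O A) (t : BalTensor X Y) : e • t = envAct X Y e t := rfl

lemma env_smul_tmul (a : A) (b : Aᵐᵒᵖ) (x : X) (y : Y) :
    (a ⊗ₜ[O] b : Env O A) • tmul x y
      = tmul ((a ⊗ₜ[O] (1 : Aᵐᵒᵖ) : Env O A) • x) (((1 : A) ⊗ₜ[O] b : Env O A) • y) := by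
  simp [smul_def, envAct, leftAct, rightAct]

instance : IsScalarTower O (Env O A) (BalTensor X Y) where
  smul_assoc c e t := by simp [smul_def]

/-- An `O`-linear map between bimodules is linear over the enveloping algebra as soon as it
respects the left and the right action of pure tensors on generators. -/
def toEnvLinear {Z : Type v} [AddCommGroup Z] [Module O Z] [Module (Env O A) Z]
    [IsScalarTower O (Env O A) Z] (f : BalTensor X Y →ₗ[O] Z)
    (hf : ∀ (a : A) (b : Aᵐᵒᵖ) x y, f ((a ⊗ₜ[O] b : Env O A) • tmul x y)
      = (a ⊗ₜ[O] b : Env O A) • f (tmul x y)) : BalTensor X Y →ₗ[Env O A] Z where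
  toFun := f
  map_add' := map_add f
  map_smul' e t := by
    induction e using TensorProduct.induction_on with
    | zero => 
      exact ((congrArg f (zero_smul (Env O A) t)).trans (map_zero f)).trans
        (zero_smul (Env O A) (f t)).symm
    | tmul a b =>
      induction t using BalTensor.induction with
      | h0 => simp
      | ht x y => exact hf a b x y
      | ha s t hs ht => simp_all [smul_add]
    | add e e' he he' => simp_all [add_smul]

lemma restrict_smul {X' : ModuleCat.{v} (Env O A)} (f : X →ₗ[Env O A] X') (e : Env O A) (x : X) :
    (f.restrictScalars O) (e • x) = e • (f.restrictScalars O) x := map_smul f e x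

/-- `f ⊗ g : X ⊗_A Y → X' ⊗_A Y'` for bimodule homomorphisms `f` and `g`. -/
def mapHom {X' Y' : ModuleCat.{v} (Env O A)} (f : X →ₗ[Env O A] X') (g : Y →ₗ[Env O A] Y') :
    BalTensor X Y →ₗ[Env O A] BalTensor X' Y' :=
  toEnvLinear (map (f.restrictScalars O) (g.restrictScalars O)
    (fun _ _ => restrict_smul f _ _) (fun _ _ => restrict_smul g _ _)) fun a b x y => by
      rw [env_smul_tmul, map_tmul, map_tmul, env_smul_tmul]
      simp only [LinearMap.restrictScalars_apply, map_smul]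

@[simp] lemma mapHom_tmul {X' Y' : ModuleCat.{v} (Env O A)} (f : X →ₗ[Env O A] X')
    (g : Y →ₗ[Env O A] Y') (x : X) (y : Y) : mapHom f g (tmul x y) = tmul (f x) (g y) :=
  map_tmul (f.restrictScalars O) (g.restrictScalars O) (fun _ _ => restrict_smul f _ _)
    (fun _ _ => restrict_smul g _ _) x y

lemma envHom_ext {Z : Type v} [AddCommGroup Z] [Module (Env O A) Z]
    {f g : BalTensor X Y →ₗ[Env O A] Z} (h : ∀ x y, f (tmul x y) = g (tmul x y)) : f = g := by
  ext t
  induction t using BalTensor.induction with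
  | h0 => simp
  | ht x y => exact h x y
  | ha s t hs ht => simp [hs, ht]

lemma pair_balanced {B : Type v} [Ring B] [Algebra O B] {φ : A →ₐ[O] B}
    (f : X →ₗ[Env O A] AlgBimod φ) (g : Y →ₗ[Env O A] AlgBimod φ) (x : X) (a : A) (y : Y) :
    f (((1 : A) ⊗ₜ[O] op a : Env O A) • x) * g y
      = f x * g ((a ⊗ₜ[O] (1 : Aᵐᵒᵖ) : Env O A) • y) := by
  have h1 := AlgBimod.tmul_smul φ 1 a (f x)
  have h2 := AlgBimod.tmul_smul φ a 1 (g y)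
  rw [map_smul, map_smul, ← op_one, h1, h2]
  simp only [map_one]
  exact (by intro p q r; simp only [mul_assoc, one_mul, mul_one] :
    ∀ p q r : B, 1 * p * q * r = p * (q * r * 1)) _ _ _

/-- For bimodule homomorphisms `f : X → B` and `g : Y → B` the map `X ⊗_A Y → B ⊗_A B → B`,
`x ⊗ y ↦ f x * g y`. -/
def pair {B : Type v} [Ring B] [Algebra O B] {φ : A →ₐ[O] B}
    (f : X →ₗ[Env O A] AlgBimod φ) (g : Y →ₗ[Env O A] AlgBimod φ) :
    BalTensor X Y →ₗ[Env O A] AlgBimod φ :=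
  toEnvLinear (lift ((LinearMap.mul O (AlgBimod φ)).compl₁₂ (f.restrictScalars O)
      (g.restrictScalars O)) (by simpa using pair_balanced f g)) fun a b x y => by
    have h1 := AlgBimod.tmul_smul φ a 1 (f x)
    have h2 := AlgBimod.tmul_smul φ 1 b.unop (g y)
    have h3 := AlgBimod.tmul_smul φ a b.unop (f x * g y)
    rw [env_smul_tmul]
    simp only [lift_tmul, LinearMap.compl₁₂_apply, LinearMap.restrictScalars_apply, map_smul,
        LinearMap.mul_apply']
    rw [op_unop] at h2 h3
    rw [← op_one, h1, h2, h3]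
    simp only [map_one]
    exact (by intro p q r s; simp only [mul_assoc, one_mul, mul_one] :
      ∀ p q r s : B, p * q * 1 * (1 * r * s) = p * (q * r) * s) _ _ _ _

@[simp] lemma pair_tmul {B : Type v} [Ring B] [Algebra O B] {φ : A →ₐ[O] B}
    (f : X →ₗ[Env O A] AlgBimod φ) (g : Y →ₗ[Env O A] AlgBimod φ) (x : X) (y : Y) :
    pair f g (tmul x y) = f x * g y :=
  lift_tmul _ (by simpa using pair_balanced f g) x y

end BalTensor

end Bimodules

section Resolutions

variable {O : Type u} {A : Type v} [CommRing O] [Ring A] [Algebra O A]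

/-- Degree `n` of the total complex `K ⊗_A K`: families with components in `K_i ⊗_A K_j`, `i + j = n`. -/
abbrev Tot (K : ChainComplex (ModuleCat.{v} (Env O A)) ℕ) (n : ℕ) : Type v :=
  ∀ p : {p : ℕ × ℕ // p.1 + p.2 = n}, BalTensor (K.X p.1.1) (K.X p.1.2)

variable (K : ChainComplex (ModuleCat.{v} (Env O A)) ℕ)

/-- The differential of `K` as a linear map. -/
abbrev dif (i j : ℕ) : K.X i →ₗ[Env O A] K.X j := (K.d i j).hom

lemma dif_dif (i j k : ℕ) (x : K.X i) : dif K j k (dif K i j x) = 0 := by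
  rw [← LinearMap.comp_apply, ← ModuleCat.hom_comp, K.d_comp_d]; rfl

/-- The projection of `K ⊗_A K` to `K_i ⊗_A K_j`. -/
def Tot.proj {n i j : ℕ} (h : i + j = n) : Tot K n →ₗ[Env O A] BalTensor (K.X i) (K.X j) :=
  LinearMap.proj (φ := fun p : {p : ℕ × ℕ // p.1 + p.2 = n} => BalTensor (K.X p.1.1) (K.X p.1.2))
    ⟨(i, j), h⟩

/-- The differential of `K ⊗_A K`: it is `d ⊗ 1 + (-1)^i (1 ⊗ d)` on `K_i ⊗_A K_j`. -/
def totD (n : ℕ) : Tot K (n + 1) →ₗ[Env O A] Tot K n :=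
  LinearMap.pi fun p =>
    BalTensor.mapHom (dif K (p.1.1 + 1) p.1.1) LinearMap.id ∘ₗ
        Tot.proj K (i := p.1.1 + 1) (j := p.1.2) (by have := p.2; omega)
      + (-1 : ℤ) ^ p.1.1 • (BalTensor.mapHom LinearMap.id (dif K (p.1.2 + 1) p.1.2) ∘ₗ
        Tot.proj K (i := p.1.1) (j := p.1.2 + 1) (by have := p.2; omega))

lemma totD_apply (n : ℕ) (t : Tot K (n + 1)) {i j : ℕ} (h : i + j = n) :
    Tot.proj K h (totD K n t)
      = BalTensor.mapHom (dif K (i + 1) i) LinearMap.id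
          (Tot.proj K (i := i + 1) (j := j) (by omega) t)
        + (-1 : ℤ) ^ i • BalTensor.mapHom LinearMap.id (dif K (j + 1) j)
          (Tot.proj K (i := i) (j := j + 1) (by omega) t) := rfl

variable {K} in
lemma Tot.ext {n : ℕ} {s t : Tot K n}
    (h : ∀ (i j : ℕ) (hn : i + j = n), Tot.proj K hn s = Tot.proj K hn t) : s = t :=
  funext fun p => h p.1.1 p.1.2 p.2

lemma mapHom_mapHom {X Y X' Y' X'' Y'' : ModuleCat.{v} (Env O A)} (f : X →ₗ[Env O A] X')
    (g : Y →ₗ[Env O A] Y') (f' : X' →ₗ[Env O A] X'') (g' : Y' →ₗ[Env O A] Y'')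
    (t : BalTensor X Y) :
    BalTensor.mapHom f' g' (BalTensor.mapHom f g t) = BalTensor.mapHom (f' ∘ₗ f) (g' ∘ₗ g) t := by
  rw [← LinearMap.comp_apply]
  congr 1
  exact BalTensor.envHom_ext fun x y => by simp

lemma mapHom_zero_left {X Y X' Y' : ModuleCat.{v} (Env O A)} (g : Y →ₗ[Env O A] Y')
    (t : BalTensor X Y) : BalTensor.mapHom (0 : X →ₗ[Env O A] X') g t = 0 := by
  have : BalTensor.mapHom (0 : X →ₗ[Env O A] X') g = 0 :=
    BalTensor.envHom_ext fun x y =>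
      (BalTensor.mapHom_tmul _ _ x y).trans ((BalTensor.mk X' Y').map_zero₂ (g y))
  rw [this]; rfl

lemma mapHom_zero_right {X Y X' Y' : ModuleCat.{v} (Env O A)} (f : X →ₗ[Env O A] X')
    (t : BalTensor X Y) : BalTensor.mapHom f (0 : Y →ₗ[Env O A] Y') t = 0 := by
  have : BalTensor.mapHom f (0 : Y →ₗ[Env O A] Y') = 0 :=
    BalTensor.envHom_ext fun x y =>
      (BalTensor.mapHom_tmul _ _ x y).trans (map_zero (BalTensor.mk X' Y' (f x)))
  rw [this]; rfl

lemma dif_comp_dif (i j k : ℕ) : dif K j k ∘ₗ dif K i j = 0 :=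
  LinearMap.ext (dif_dif K i j k)

lemma totD_totD (n : ℕ) (t : Tot K (n + 2)) : totD K n (totD K (n + 1) t) = 0 := by
  refine Tot.ext fun i j h => ?_
  rw [map_zero, totD_apply, totD_apply, totD_apply]
  simp only [map_add, map_zsmul, mapHom_mapHom, dif_comp_dif, LinearMap.id_comp, LinearMap.comp_id,
    mapHom_zero_left, mapHom_zero_right, smul_zero, zero_add, add_zero, pow_succ]
  simp

/-- The chain complex of bimodules `K ⊗_A K`. -/
def tensorComplex : ChainComplex (ModuleCat.{v} (Env O A)) ℕ :=
  ChainComplex.of (fun n => ModuleCat.of (Env O A) (Tot K n)) (fun n => ModuleCat.ofHom (totD K n))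
    fun n => by
      ext t : 2
      exact totD_totD K n t

lemma tensorComplex_d (n : ℕ) :
    (tensorComplex K).d (n + 1) n = ModuleCat.ofHom (totD K n) :=
  ChainComplex.of_d (fun n => ModuleCat.of (Env O A) (Tot K n))
    (fun n => ModuleCat.ofHom (totD K n)) n

variable (P : ProjectiveResolution (regular O A))

/-- The augmentation `P_0 → A`. -/
def aug : P.complex.X 0 →ₗ[Env O A] AlgBimod (AlgHom.id O A) := (P.π.f 0).hom

/-- The augmentation `P_0 ⊗_A P_0 → A ⊗_A A = A`. -/
def tensorAug : Tot P.complex 0 →ₗ[Env O A] AlgBimod (AlgHom.id O A) :=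
  BalTensor.pair (aug P) (aug P) ∘ₗ Tot.proj P.complex (i := 0) (j := 0) rfl

/-- A chain map `P → P ⊗_A P` of complexes of bimodules which lifts the identity on `A = A ⊗_A A`
(such a map is automatically a homotopy equivalence, and unique up to homotopy). -/
structure Diagonal where
  hom : P.complex ⟶ tensorComplex P.complex
  hom_aug : tensorAug P ∘ₗ (hom.f 0).hom = aug P

variable {P} in
/-- The component `P_n → P_i ⊗_A P_j`. -/
def Diagonal.comp (h : Diagonal P) {i j n : ℕ} (hn : i + j = n) :
    P.complex.X n →ₗ[Env O A] BalTensor (P.complex.X i) (P.complex.X j) :=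
  Tot.proj P.complex hn ∘ₗ (h.hom.f n).hom

variable {P} in
lemma Diagonal.comm (h : Diagonal P) {i j n : ℕ} (hn : i + j = n) (x : P.complex.X (n + 1)) :
    BalTensor.mapHom (dif P.complex (i + 1) i) LinearMap.id
        (h.comp (i := i + 1) (j := j) (n := n + 1) (by omega) x)
      + (-1 : ℤ) ^ i • BalTensor.mapHom LinearMap.id (dif P.complex (j + 1) j)
        (h.comp (i := i) (j := j + 1) (n := n + 1) (by omega) x)
      = h.comp hn (dif P.complex (n + 1) n x) := by
  have h1 := h.hom.comm (n + 1) n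
  rw [tensorComplex_d] at h1
  exact congrArg (fun f => Tot.proj P.complex hn (f.hom x)) h1

section Cochains

variable (M : Type v) [AddCommGroup M] [Module O M] [Module (Env O A) M] [IsScalarTower O (Env O A) M]

/-- Precomposition with the differential, `Hom(K_i, M) → Hom(K_j, M)`, `f ↦ f ∘ d`. -/
def precompD (i j : ℕ) : (K.X i →ₗ[Env O A] M) →ₗ[O] (K.X j →ₗ[Env O A] M) where
  toFun f := f ∘ₗ dif K j i
  map_add' _ _ := rfl
  map_smul' _ _ := rfl

/-- The cochain complex of `O`-modules `Hom_{Aᵉ}(K, M)`, with differential `f ↦ f ∘ d`. -/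
def homComplex : CochainComplex (ModuleCat.{v} O) ℕ where
  X n := ModuleCat.of O (K.X n →ₗ[Env O A] M)
  d i j := ModuleCat.ofHom (precompD K M i j)
  shape i j hij := by
    ext f : 2
    exact LinearMap.ext fun x => by
      change f (dif K j i x) = 0
      rw [dif, K.shape j i hij]
      exact map_zero f
  d_comp_d' i j k _ _ := by
    ext f : 2
    exact LinearMap.ext fun x => by
      change f (dif K _ _ (dif K _ _ x)) = 0
      rw [dif_dif, map_zero]

variable {M} {M' : Type v} [AddCommGroup M'] [Module O M'] [Module (Env O A) M']
  [IsScalarTower O (Env O A) M']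

/-- Postcomposition with a bimodule homomorphism, on cochains. -/
def postcomp (φ : M →ₗ[Env O A] M') (n : ℕ) :
    (K.X n →ₗ[Env O A] M) →ₗ[O] (K.X n →ₗ[Env O A] M') where
  toFun f := φ ∘ₗ f
  map_add' f g := LinearMap.ext fun x => map_add φ _ _
  map_smul' c f := LinearMap.ext fun x => by
    change φ (c • f x) = c • φ (f x)
    rw [← algebraMap_smul (Env O A) c (f x), map_smul, algebraMap_smul]

/-- The map of cochain complexes `Hom_{Aᵉ}(K, M) → Hom_{Aᵉ}(K, M')` induced by `M → M'`. -/
def homComplexMap (φ : M →ₗ[Env O A] M') : homComplex K M ⟶ homComplex K M' where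
  f n := ModuleCat.ofHom (postcomp K φ n)
  comm' _ _ _ := rfl

end Cochains
end Resolutions

lemma projective_trans (S E X : Type*) [Ring S] [Ring E] [Module S E] [IsScalarTower S E E]
    [AddCommGroup X] [Module E X] [Module S X] [IsScalarTower S E X] [Module.Projective S E]
    [Module.Projective E X] : Module.Projective S X := by
  obtain ⟨s, hs⟩ := Module.projective_def'.1 (inferInstance : Module.Projective E X)
  classical
  have : Module.Projective S (X →₀ E) :=
    Module.Projective.of_equiv (finsuppLEquivDirectSum S E X).symm
  refine Module.Projective.of_split (s.restrictScalars S)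
    ((Finsupp.linearCombination E id).restrictScalars S) ?_
  ext x
  exact LinearMap.congr_fun hs x

lemma projective_compHom {S E X : Type*} [Ring S] [Ring E] (ι : S →+* E)
    [AddCommGroup X] [Module E X] [Module.Projective E X]
    (hE : @Module.Projective S _ E _ (Module.compHom E ι)) :
    @Module.Projective S _ X _ (Module.compHom X ι) := by
  let := Module.compHom E ι
  let := Module.compHom X ι
  have : IsScalarTower S E E := ⟨fun s e x => mul_assoc (ι s) e x⟩
  have : IsScalarTower S E X := ⟨fun s e x => mul_smul (ι s) e x⟩
  exact projective_trans S E X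

/-- An exact complex of projective modules, bounded on the right by a split surjection, is
contractible. -/
lemma exists_contraction {S : Type*} [Ring S] (C : ℕ → Type*) [∀ n, AddCommGroup (C n)]
    [∀ n, Module S (C n)] [∀ n, Module.Projective S (C n)] {Z : Type*} [AddCommGroup Z] [Module S Z]
    (d : ∀ n, C (n + 1) →ₗ[S] C n) (ε : C 0 →ₗ[S] Z) (σ : Z →ₗ[S] C 0)
    (hσ : ε ∘ₗ σ = LinearMap.id) (h0 : Function.Exact (d 0) ε)
    (hd : ∀ n, Function.Exact (d (n + 1)) (d n)) :
    ∃ s : ∀ n, C n →ₗ[S] C (n + 1), (∀ x, d 0 (s 0 x) = x - σ (ε x)) ∧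
      ∀ n x, d (n + 1) (s (n + 1) x) = x - s n (d n x) := by
  have lift : ∀ n (φ : C n →ₗ[S] C n), (∀ x, φ x ∈ LinearMap.range (d n)) →
      ∃ s : C n →ₗ[S] C (n + 1), d n ∘ₗ s = φ := fun n φ hφ => by
    obtain ⟨s, hs⟩ := Module.projective_lifting_property (d n).rangeRestrict
      (φ.codRestrict _ hφ) (d n).surjective_rangeRestrict
    exact ⟨s, LinearMap.ext fun x => congrArg Subtype.val (LinearMap.congr_fun hs x)⟩
  have step : ∀ n (s : C n →ₗ[S] C (n + 1)), d n ∘ₗ s ∘ₗ d n = d n →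
      ∃ s' : C (n + 1) →ₗ[S] C (n + 2), d (n + 1) ∘ₗ s' = LinearMap.id - s ∘ₗ d n := by
    intro n s hs
    refine lift (n + 1) _ fun x => (hd n _).1 ?_
    have := LinearMap.congr_fun hs x
    simpa [sub_eq_zero] using this.symm
  have step' : ∀ n (s : C n →ₗ[S] C (n + 1)) (hs : d n ∘ₗ s ∘ₗ d n = d n)
      (s' : C (n + 1) →ₗ[S] C (n + 2)), d (n + 1) ∘ₗ s' = LinearMap.id - s ∘ₗ d n →
      d (n + 1) ∘ₗ s' ∘ₗ d (n + 1) = d (n + 1) := by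
    intro n s hs s' h
    rw [← LinearMap.comp_assoc, h]
    ext x
    simp [(hd n).apply_apply_eq_zero]
  obtain ⟨s0, hs0⟩ := lift 0 (LinearMap.id - σ ∘ₗ ε) fun x => (h0 _).1 (by
    simpa [sub_eq_zero] using (LinearMap.congr_fun hσ (ε x)).symm)
  have hs0' : d 0 ∘ₗ s0 ∘ₗ d 0 = d 0 := by
    rw [← LinearMap.comp_assoc, hs0]
    ext x
    simp [h0.apply_apply_eq_zero]
  choose nx hnx using step
  let T : ∀ n, {s : C n →ₗ[S] C (n + 1) // d n ∘ₗ s ∘ₗ d n = d n} := fun n =>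
    Nat.rec ⟨s0, hs0'⟩ (fun n s => ⟨nx n s.1 s.2, step' n s.1 s.2 _ (hnx n s.1 s.2)⟩) n
  refine ⟨fun n => (T n).1, fun x => LinearMap.congr_fun hs0 x, fun n x =>
    LinearMap.congr_fun (hnx n (T n).1 (T n).2) x⟩

section Existence

variable {O : Type u} {A : Type v} [CommRing O] [Ring A] [Algebra O A]

lemma env_projective [Module.Projective O A] :
    @Module.Projective Aᵐᵒᵖ _ (Env O A) _ (Module.compHom (Env O A)
      (Algebra.TensorProduct.includeRight : Aᵐᵒᵖ →ₐ[O] Env O A).toRingHom) := by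
  let i1 : Module Aᵐᵒᵖ (Env O A) := Module.compHom (Env O A)
      (Algebra.TensorProduct.includeRight : Aᵐᵒᵖ →ₐ[O] Env O A).toRingHom
  have h : Module.Projective Aᵐᵒᵖ (Aᵐᵒᵖ ⊗[O] A) := inferInstance
  let e := TensorProduct.comm O Aᵐᵒᵖ A
  have he : ∀ (b : Aᵐᵒᵖ) (t : Aᵐᵒᵖ ⊗[O] A), e (b • t) = ((1 : A) ⊗ₜ[O] b : Env O A) * e t := by
    intro b t
    induction t using TensorProduct.induction_on with
    | zero => simp
    | tmul x y => simp [e, TensorProduct.smul_tmul']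
    | add x y hx hy => rw [smul_add, map_add, hx, hy, map_add, mul_add]
  let e' : (Aᵐᵒᵖ ⊗[O] A) ≃ₗ[Aᵐᵒᵖ] Env O A :=
    { e.toAddEquiv with map_smul' := he }
  exact Module.Projective.of_equiv e'


lemma base_smul (X : ModuleCat.{v} (Env O A)) (c : O) (x : X) :
    c • x = ((1 : A) ⊗ₜ[O] (algebraMap O Aᵐᵒᵖ c) : Env O A) • x := by
  rw [← Algebra.TensorProduct.algebraMap_apply', algebraMap_smul]

variable (P : ProjectiveResolution (regular O A))

lemma aug_dif (x : P.complex.X 1) : aug P (dif P.complex 1 0 x) = 0 :=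
  congrArg (fun φ => φ.hom x) P.complex_d_comp_π_f_zero

lemma aug_surjective : Function.Surjective (aug P) :=
  (ModuleCat.epi_iff_surjective (P.π.f 0)).1 inferInstance

lemma exact_aug : Function.Exact (dif P.complex 1 0) (aug P) := by
  intro x
  refine ⟨(ShortComplex.moduleCat_exact_iff _).1 P.exact₀ x, ?_⟩
  rintro ⟨y, rfl⟩
  exact aug_dif P y

lemma exact_dif (n : ℕ) :
    Function.Exact (dif P.complex (n + 2) (n + 1)) (dif P.complex (n + 1) n) := by
  intro x
  refine ⟨(ShortComplex.moduleCat_exact_iff _).1 (P.exact_succ n) x, ?_⟩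
  rintro ⟨y, rfl⟩
  exact dif_dif P.complex _ _ _ y

/-- The resolution `P → A` is contractible as a complex of right `A`-modules. -/
lemma exists_right_contraction [Module.Projective O A] (p : P.complex.X 0) (hp : aug P p = 1) :
    ∃ s : ∀ n, P.complex.X n →ₗ[O] P.complex.X (n + 1),
      (∀ n (a : A) x, s n (((1 : A) ⊗ₜ[O] op a : Env O A) • x)
        = ((1 : A) ⊗ₜ[O] op a : Env O A) • s n x) ∧
      (∀ x, dif P.complex 1 0 (s 0 x) = x - ((1 : A) ⊗ₜ[O] op (aug P x : A) : Env O A) • p) ∧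
      ∀ n x, dif P.complex (n + 2) (n + 1) (s (n + 1) x)
        = x - s n (dif P.complex (n + 1) n x) := by
  let ι := (Algebra.TensorProduct.includeRight : Aᵐᵒᵖ →ₐ[O] Env O A).toRingHom
  let inst : ∀ n, Module Aᵐᵒᵖ (P.complex.X n) := fun n => Module.compHom _ ι
  have hproj : ∀ n, Module.Projective Aᵐᵒᵖ (P.complex.X n) := fun n =>
    projective_compHom ι (X := P.complex.X n) env_projective
  let instA : Module Aᵐᵒᵖ (AlgBimod (AlgHom.id O A)) := Module.compHom _ ι
  let toR : ∀ {X Y : Type v} [AddCommGroup X] [AddCommGroup Y] [Module (Env O A) X]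
    [Module (Env O A) Y] (f : X →ₗ[Env O A] Y),
    @LinearMap Aᵐᵒᵖ Aᵐᵒᵖ _ _ (RingHom.id _) X Y _ _ (Module.compHom _ ι) (Module.compHom _ ι) :=
    fun {X Y} _ _ _ _ f =>
      letI := Module.compHom X ι
      letI := Module.compHom Y ι
      { f.toAddMonoidHom with map_smul' := fun b x => map_smul f (ι b) x }
  let σ : AlgBimod (AlgHom.id O A) →ₗ[Aᵐᵒᵖ] P.complex.X 0 :=
    { toFun := fun z => ((1 : A) ⊗ₜ[O] op (z : A) : Env O A) • p
      map_add' := fun z w => by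
        rw [← add_smul, ← TensorProduct.tmul_add]; rfl
      map_smul' := fun b z => by
        have h1 : (b • z : AlgBimod (AlgHom.id O A)) = _ := AlgBimod.tmul_smul (AlgHom.id O A) 1 b.unop z
        rw [h1]
        change _ = ((1 : A) ⊗ₜ[O] b : Env O A) • ((1 : A) ⊗ₜ[O] op (z : A) : Env O A) • p
        rw [smul_smul, Algebra.TensorProduct.tmul_mul_tmul, one_mul, map_one]
        congr 3
        exact congrArg (· * b.unop) (one_mul (M := A) z) }
  obtain ⟨s, hs0, hs⟩ := exists_contraction (S := Aᵐᵒᵖ) (fun n => P.complex.X n)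
    (fun n => toR (dif P.complex (n + 1) n)) (toR (aug P)) σ
    (by
      refine LinearMap.ext fun z => ?_
      change aug P (((1 : A) ⊗ₜ[O] op (z : A) : Env O A) • p) = z
      rw [map_smul, hp]
      refine (AlgBimod.tmul_smul (AlgHom.id O A) 1 z 1).trans ?_
      exact (by intro z; simp : ∀ z : A, AlgHom.id O A 1 * 1 * AlgHom.id O A z = z) z)
    (exact_aug P) (exact_dif P)
  refine ⟨fun n => { (s n).toAddMonoidHom with map_smul' := fun c x => ?_ },
    fun n a x => map_smul (s n) (op a) x, hs0, hs⟩
  rw [base_smul]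
  refine (map_smul (s n) (algebraMap O Aᵐᵒᵖ c) x).trans ?_
  exact (base_smul _ c _).symm


/-- The left action of `A` on a bimodule. -/
def lmul (Y : ModuleCat.{v} (Env O A)) : AlgBimod (AlgHom.id O A) →ₗ[O] Y →ₗ[O] Y :=
  ((BalTensor.act Y).comp (Algebra.TensorProduct.includeLeft : A →ₐ[O] Env O A)).toLinearMap

lemma lmul_apply (Y : ModuleCat.{v} (Env O A)) (a : AlgBimod (AlgHom.id O A)) (y : Y) :
    lmul Y a y = ((a : A) ⊗ₜ[O] (1 : Aᵐᵒᵖ) : Env O A) • y := rfl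

lemma lmul_right (Y : ModuleCat.{v} (Env O A)) (b : AlgBimod (AlgHom.id O A)) (a : A) (y : Y) :
    lmul Y (((1 : A) ⊗ₜ[O] op a : Env O A) • b) y
      = lmul Y b ((a ⊗ₜ[O] (1 : Aᵐᵒᵖ) : Env O A) • y) := by
  have h1 : ((1 : A) ⊗ₜ[O] op a : Env O A) • b = @HMul.hMul A A A _ b a :=
    (AlgBimod.tmul_smul (AlgHom.id O A) 1 a b).trans (congrArg (· * a) (one_mul (M := A) b))
  have h2 : ∀ b : A, lmul Y (b * a : A) y = lmul Y (b : A) ((a ⊗ₜ[O] (1 : Aᵐᵒᵖ) : Env O A) • y) :=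
    fun b => by
      change ((b * a : A) ⊗ₜ[O] (1 : Aᵐᵒᵖ) : Env O A) • y
        = (b ⊗ₜ[O] (1 : Aᵐᵒᵖ) : Env O A) • (a ⊗ₜ[O] (1 : Aᵐᵒᵖ) : Env O A) • y
      rw [smul_smul, Algebra.TensorProduct.tmul_mul_tmul, one_mul]
  rw [h1]
  exact h2 b

/-- `ε ⊗ 1 : P_0 ⊗_A Y → A ⊗_A Y = Y`. -/
def augLeft (Y : ModuleCat.{v} (Env O A)) : BalTensor (P.complex.X 0) Y →ₗ[O] Y :=
  BalTensor.lift ((lmul Y).comp ((aug P).restrictScalars O)) (fun x a y =>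
    (congrArg (fun b => lmul Y b y) (map_smul (aug P) _ x)).trans (lmul_right Y (aug P x) a y))

lemma augLeft_tmul (Y : ModuleCat.{v} (Env O A)) (x : P.complex.X 0) (y : Y) :
    augLeft P Y (BalTensor.tmul x y) = lmul Y (aug P x) y :=
  BalTensor.lift_tmul _ _ x y

lemma augLeft_map {Y Z : ModuleCat.{v} (Env O A)} (g : Y →ₗ[Env O A] Z)
    (t : BalTensor (P.complex.X 0) Y) :
    augLeft P Z (BalTensor.mapHom LinearMap.id g t) = g (augLeft P Y t) := by
  induction t using BalTensor.induction with
  | h0 => simp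
  | ht x y =>
    rw [BalTensor.mapHom_tmul, augLeft_tmul, augLeft_tmul, lmul_apply, lmul_apply, map_smul]; rfl
  | ha s t hs ht => simp only [map_add, hs, ht]

lemma augLeft_dif {Y : ModuleCat.{v} (Env O A)} (t : BalTensor (P.complex.X 1) Y) :
    augLeft P Y (BalTensor.mapHom (dif P.complex 1 0) LinearMap.id t) = 0 := by
  induction t using BalTensor.induction with
  | h0 => simp
  | ht x y =>
    rw [BalTensor.mapHom_tmul, augLeft_tmul, aug_dif, map_zero]; rfl
  | ha s t hs ht => simp only [map_add, hs, ht, add_zero]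

lemma pair_eq (t : BalTensor (P.complex.X 0) (P.complex.X 0)) :
    BalTensor.pair (aug P) (aug P) t = aug P (augLeft P _ t) := by
  induction t using BalTensor.induction with
  | h0 => simp
  | ht x y =>
    rw [BalTensor.pair_tmul, augLeft_tmul, lmul_apply, map_smul]
    refine Eq.trans ?_ (AlgBimod.tmul_smul (AlgHom.id O A) (aug P x) 1 (aug P y)).symm
    exact (by intro a b; simp : ∀ a b : A, a * b = AlgHom.id O A a * b * AlgHom.id O A 1) _ _
  | ha s t hs ht => simp only [map_add, hs, ht]

/-- Exactness of `P ⊗_A P → A`. -/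
lemma tot_key [Module.Projective O A] (n : ℕ) (t : Tot P.complex n)
    (h0 : ∃ w, dif P.complex (n + 1) n w
      = augLeft P _ (Tot.proj P.complex (i := 0) (j := n) (Nat.zero_add n) t))
    (h1 : ∀ (i j : ℕ) (hn : i + 1 + j = n),
      BalTensor.mapHom (dif P.complex (i + 1) i) LinearMap.id (Tot.proj P.complex hn t)
        + (-1 : ℤ) ^ i • BalTensor.mapHom LinearMap.id (dif P.complex (j + 1) j)
          (Tot.proj P.complex (i := i) (j := j + 1) (by omega) t) = 0) :
    ∃ u, totD P.complex n u = t := by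
  obtain ⟨p, hp⟩ := aug_surjective P 1
  obtain ⟨s, hsr, hs0, hs⟩ := exists_right_contraction P p hp
  obtain ⟨w, hw⟩ := h0
  let S : ∀ i j, BalTensor (P.complex.X i) (P.complex.X j) →ₗ[O]
      BalTensor (P.complex.X (i + 1)) (P.complex.X j) := fun i j =>
    BalTensor.map (s i) LinearMap.id (hsr i) (fun _ _ => rfl)
  have S_tmul : ∀ i j x y, S i j (BalTensor.tmul x y) = BalTensor.tmul (s i x) y :=
    fun i j x y => BalTensor.map_tmul _ _ _ _ x y
  have sub_tmul : ∀ {X Y : ModuleCat.{v} (Env O A)} (x x' : X) (y : Y),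
      BalTensor.tmul (x - x') y = BalTensor.tmul x y - BalTensor.tmul x' y :=
    fun {X Y} x x' y => (BalTensor.mk X Y).map_sub₂ x x' y
  have LA : ∀ j x, BalTensor.mapHom (dif P.complex 1 0) LinearMap.id (S 0 j x)
      = x - BalTensor.tmul p (augLeft P _ x) := by
    intro j x
    induction x using BalTensor.induction with
    | h0 =>
      rw [map_zero, map_zero, map_zero, zero_sub, eq_comm, neg_eq_zero]
      exact map_zero (BalTensor.mk _ _ p)
    | ht x y =>
      rw [S_tmul, BalTensor.mapHom_tmul, hs0, sub_tmul, augLeft_tmul]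
      exact congrArg (BalTensor.tmul x y - ·) (BalTensor.balanced p _ y)
    | ha s t hs ht => rw [map_add, map_add, hs, ht, map_add, BalTensor.tmul_add]; abel
  have LB : ∀ i j x, BalTensor.mapHom (dif P.complex (i + 2) (i + 1)) LinearMap.id (S (i + 1) j x)
      = x - S i j (BalTensor.mapHom (dif P.complex (i + 1) i) LinearMap.id x) := by
    intro i j x
    induction x using BalTensor.induction with
    | h0 => simp
    | ht x y =>
      rw [S_tmul, BalTensor.mapHom_tmul, hs, sub_tmul, BalTensor.mapHom_tmul, S_tmul]
      rfl
    | ha s t hs ht => simp only [map_add, hs, ht]; abel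
  have LC : ∀ i j j' (g : P.complex.X j →ₗ[Env O A] P.complex.X j') x,
      BalTensor.mapHom LinearMap.id g (S i j x) = S i j' (BalTensor.mapHom LinearMap.id g x) := by
    intro i j j' g x
    induction x using BalTensor.induction with
    | h0 => simp
    | ht x y =>
      rw [S_tmul, BalTensor.mapHom_tmul, BalTensor.mapHom_tmul, S_tmul]
      rfl
    | ha s t hs ht => simp only [map_add, hs, ht]
  let w' : ∀ j, P.complex.X j := fun j => if h : n + 1 = j then h ▸ w else 0
  have hw' : w' (n + 1) = w := by simp [w']
  let u : Tot P.complex (n + 1) := fun q => match q with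
    | ⟨(0, j), hj⟩ => BalTensor.tmul p (w' j)
    | ⟨(i + 1, j), hj⟩ => S i j (Tot.proj P.complex (by simp only at hj; omega) t)
  have u0 : ∀ j hj, Tot.proj P.complex (i := 0) (j := j) hj u = BalTensor.tmul p (w' j) :=
    fun _ _ => rfl
  have us : ∀ i j (hj : i + j = n), Tot.proj P.complex (i := i + 1) (j := j) (by omega) u
      = S i j (Tot.proj P.complex hj t) := fun _ _ _ => rfl
  refine ⟨u, Tot.ext fun i j hn => ?_⟩
  rw [totD_apply]
  cases i with
  | zero =>
    obtain rfl : j = n := by omega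
    rw [us 0 j hn, LA, u0, BalTensor.mapHom_tmul, hw', hw, pow_zero, one_smul]
    exact sub_add_cancel _ _
  | succ i =>
    rw [us (i + 1) j hn, LB, us i (j + 1) (by omega), LC, pow_succ, mul_neg_one, neg_smul,
      ← map_zsmul, ← sub_eq_add_neg, sub_sub, ← map_add, h1 i j hn, map_zero, sub_zero]

lemma tot_exact_zero [Module.Projective O A] (t : Tot P.complex 0) (ht : tensorAug P t = 0) :
    ∃ u, totD P.complex 0 u = t := by
  refine tot_key P 0 t ?_ fun i j hn => by omega
  exact (exact_aug P _).1 ((pair_eq P _).symm.trans ht)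

lemma tot_exact_succ [Module.Projective O A] (n : ℕ) (t : Tot P.complex (n + 1))
    (ht : totD P.complex n t = 0) : ∃ u, totD P.complex (n + 1) u = t := by
  have h : ∀ (i j : ℕ) (hn : i + j = n), _ = _ := fun i j hn =>
    (totD_apply P.complex n t hn).symm.trans ((congrArg (Tot.proj P.complex hn) ht).trans
      (map_zero _))
  refine tot_key P (n + 1) t ?_ fun i j hn => h i j (by omega)
  refine (exact_dif P n _).1 ?_
  rw [← augLeft_map]
  have h' := congrArg (augLeft P _) (h 0 n (Nat.zero_add n))
  rw [map_add, augLeft_dif, zero_add, pow_zero, one_smul, map_zero] at h'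
  exact h'

lemma tensorAug_surjective : Function.Surjective (tensorAug P) := by
  intro a
  obtain ⟨x, hx⟩ := aug_surjective P a
  obtain ⟨y, hy⟩ := aug_surjective P 1
  refine ⟨fun q => match q with
    | ⟨(0, 0), _⟩ => BalTensor.tmul x y
    | ⟨(i + 1, j), h⟩ => 0
    | ⟨(0, j + 1), h⟩ => 0, ?_⟩
  refine (BalTensor.pair_tmul (aug P) (aug P) x y).trans ?_
  rw [hx, hy, mul_one]

lemma tensorAug_totD (t : Tot P.complex 1) : tensorAug P (totD P.complex 0 t) = 0 := by
  refine (pair_eq P _).trans ?_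
  rw [totD_apply, map_add, map_add, augLeft_dif, map_zero, zero_add, pow_zero, one_smul,
    augLeft_map, aug_dif]

/-- A diagonal map `P → P ⊗_A P` over `A` exists. -/
lemma Diagonal.nonempty [Module.Projective O A] : Nonempty (Diagonal P) := by
  let T := tensorComplex P.complex
  have hp : ∀ n, Module.Projective (Env O A) (P.complex.X n) := fun n => inferInstance
  have lift : ∀ (n : ℕ) {X Y : Type v} [AddCommGroup X] [Module (Env O A) X] [AddCommGroup Y]
      [Module (Env O A) Y] (α : X →ₗ[Env O A] Y) (β : P.complex.X n →ₗ[Env O A] Y),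
      (∀ x, ∃ y, α y = β x) → ∃ γ, α ∘ₗ γ = β := by
    intro n X Y _ _ _ _ α β hβ
    obtain ⟨s, hs⟩ := Module.projective_lifting_property α.rangeRestrict
      (β.codRestrict (LinearMap.range α) hβ) α.surjective_rangeRestrict
    exact ⟨s, LinearMap.ext fun x => congrArg Subtype.val (LinearMap.congr_fun hs x)⟩
  obtain ⟨h0, e0⟩ := lift 0 (tensorAug P) (aug P) fun x => tensorAug_surjective P _
  obtain ⟨h1, e1⟩ := lift 1 (totD P.complex 0) (h0 ∘ₗ dif P.complex 1 0) fun x =>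
    tot_exact_zero P _ (by
      refine (LinearMap.congr_fun e0 (dif P.complex 1 0 x)).trans (aug_dif P x))
  refine ⟨⟨ChainComplex.mkHom P.complex T (ModuleCat.ofHom h0) (ModuleCat.ofHom h1) ?_ ?_, ?_⟩⟩
  · rw [tensorComplex_d]
    ext x : 2
    exact LinearMap.congr_fun e1 x
  · rintro n ⟨f, f', hf⟩
    have hf' : ∀ x, totD P.complex n (f'.hom x) = f.hom (dif P.complex (n + 1) n x) := fun x => by
      rw [tensorComplex_d] at hf
      exact congrArg (fun φ => φ.hom x) hf
    have ex := lift (n + 2) (totD P.complex (n + 1))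
      (f'.hom ∘ₗ dif P.complex (n + 2) (n + 1)) fun x => tot_exact_succ P n _ (by
        refine (hf' _).trans ?_
        rw [dif_dif]
        exact map_zero f.hom)
    refine ⟨ModuleCat.ofHom ex.choose, ?_⟩
    rw [tensorComplex_d]
    ext x : 2
    exact LinearMap.congr_fun ex.choose_spec x
  · exact e0

end Existence

section Bockstein

variable {O : Type u} {A : Type v} [CommRing O] [Ring A] [Algebra O A]

variable (A) in
/-- The ideal `π^s A` of `A`. -/
def powIdeal (π : O) (s : ℕ) : Ideal A := Ideal.span {algebraMap O A (π ^ s)}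

lemma mem_powIdeal {π : O} {s : ℕ} {a : A} : a ∈ powIdeal A π s ↔ ∃ b : A, π ^ s • b = a := by
  simp only [powIdeal, Ideal.mem_span_singleton', Algebra.smul_def, Algebra.commutes]

instance (π : O) (s : ℕ) : (powIdeal A π s).IsTwoSided where
  mul_mem_of_left b ha := by
    obtain ⟨c, rfl⟩ := mem_powIdeal.1 ha
    exact mem_powIdeal.2 ⟨c * b, by simp⟩

variable (A) in
/-- The bimodule (and algebra) `A / π^s A`. -/
abbrev QuotPow (π : O) (s : ℕ) : Type v := AlgBimod (Ideal.Quotient.mkₐ O (powIdeal A π s))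

/-- The class of `a` in `A / π^s A`. -/
def QuotPow.mk (π : O) (s : ℕ) : A →ₗ[O] QuotPow A π s :=
  (Ideal.Quotient.mkₐ O (powIdeal A π s)).toLinearMap

lemma QuotPow.mk_surjective (π : O) (s : ℕ) : Function.Surjective (QuotPow.mk (A := A) π s) :=
  Ideal.Quotient.mkₐ_surjective O (powIdeal A π s)

lemma QuotPow.mk_eq_zero {π : O} {s : ℕ} {a : A} :
    QuotPow.mk π s a = 0 ↔ ∃ b : A, π ^ s • b = a :=
  Ideal.Quotient.eq_zero_iff_mem.trans mem_powIdeal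

lemma QuotPow.smul_mk (π : O) (s : ℕ) (a : A) (b : Aᵐᵒᵖ) (c : A) :
    (a ⊗ₜ[O] b : Env O A) • QuotPow.mk π s c = QuotPow.mk π s (a * c * b.unop) :=
  AlgBimod.tmul_smul _ a b.unop _

/-- The additive map underlying `QuotPow.lift`. -/
def QuotPow.lift.aux (π : O) (s t : ℕ) (c : O)
    (h : ∀ a : A, QuotPow.mk π t (c • π ^ s • a) = 0) : QuotPow A π s →+ QuotPow A π t where
  toFun x := Quotient.liftOn' x (fun a => QuotPow.mk π t (c • a)) fun a b hab => by
    obtain ⟨d, hd⟩ := mem_powIdeal.1 ((Submodule.quotientRel_def _).1 hab)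
    rw [← sub_eq_zero, ← map_sub, ← smul_sub, ← hd, h]
  map_zero' := by
    change QuotPow.mk π t (c • 0) = 0
    rw [smul_zero, map_zero]
  map_add' x y := by
    obtain ⟨a, rfl⟩ := QuotPow.mk_surjective π s x
    obtain ⟨b, rfl⟩ := QuotPow.mk_surjective π s y
    rw [← map_add]
    change QuotPow.mk π t _ = QuotPow.mk π t _ + QuotPow.mk π t _
    rw [smul_add, map_add]

/-- The bimodule homomorphism `A / π^s A → A / π^t A` induced by multiplication with `c` on `A`. -/
def QuotPow.lift (π : O) (s t : ℕ) (c : O) (h : ∀ a : A, QuotPow.mk π t (c • π ^ s • a) = 0) :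
    QuotPow A π s →ₗ[Env O A] QuotPow A π t where
  toFun := QuotPow.lift.aux π s t c h
  map_add' := map_add _
  map_smul' e x := by
    obtain ⟨d, rfl⟩ := QuotPow.mk_surjective π s x
    induction e using TensorProduct.induction_on with
    | zero => 
      change QuotPow.lift.aux π s t c h _ = (0 : Env O A) • QuotPow.lift.aux π s t c h _
      exact ((congrArg _ (zero_smul (Env O A) (QuotPow.mk π s d))).trans (map_zero _)).trans
        (zero_smul (Env O A) (QuotPow.lift.aux π s t c h (QuotPow.mk π s d))).symm
    | tmul a b =>
      rw [QuotPow.smul_mk, RingHom.id_apply]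
      change QuotPow.mk π t _ = (a ⊗ₜ[O] b : Env O A) • QuotPow.mk π t _
      rw [QuotPow.smul_mk]
      simp
    | add e e' he he' =>
      change QuotPow.lift.aux π s t c h _ = (e + e') • QuotPow.lift.aux π s t c h _
      rw [add_smul, add_smul, map_add]
      exact congrArg₂ (· + ·) he he'

lemma QuotPow.lift_mk (π : O) (s t : ℕ) (c : O) (h) (a : A) :
    QuotPow.lift π s t c h (QuotPow.mk π s a) = QuotPow.mk π t (c • a) := rfl

/-- The bimodule homomorphism `A / π^r A → A / π^{2r} A` given by multiplication with `π^r`. -/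
def inclPow (π : O) (r : ℕ) : QuotPow A π r →ₗ[Env O A] QuotPow A π (2 * r) :=
  QuotPow.lift π r (2 * r) (π ^ r) fun a =>
    QuotPow.mk_eq_zero.2 ⟨a, by rw [smul_smul, two_mul, pow_add]⟩

/-- The canonical surjection `A / π^{2r} A → A / π^r A`. -/
def projPow (π : O) (r : ℕ) : QuotPow A π (2 * r) →ₗ[Env O A] QuotPow A π r :=
  QuotPow.lift π (2 * r) r 1 fun a =>
    QuotPow.mk_eq_zero.2 ⟨π ^ r • a, by rw [smul_smul, one_smul, two_mul, pow_add]⟩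

lemma inclPow_mk (π : O) (r : ℕ) (a : A) :
    inclPow π r (QuotPow.mk π r a) = QuotPow.mk π (2 * r) (π ^ r • a) := rfl

lemma projPow_mk (π : O) (r : ℕ) (a : A) :
    projPow π r (QuotPow.mk π (2 * r) a) = QuotPow.mk π r a :=
  congrArg (QuotPow.mk π r) (one_smul O a)

lemma projPow_surjective (π : O) (r : ℕ) : Function.Surjective (projPow (A := A) π r) := fun x => by
  obtain ⟨a, rfl⟩ := QuotPow.mk_surjective π r x
  exact ⟨_, projPow_mk π r a⟩

lemma projPow_inclPow (π : O) (r : ℕ) (x : QuotPow A π r) : projPow π r (inclPow π r x) = 0 := by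
  obtain ⟨a, rfl⟩ := QuotPow.mk_surjective π r x
  rw [inclPow_mk, projPow_mk, QuotPow.mk_eq_zero]
  exact ⟨a, rfl⟩

lemma exists_inclPow (π : O) (r : ℕ) (x : QuotPow A π (2 * r)) (hx : projPow π r x = 0) :
    ∃ y, inclPow π r y = x := by
  obtain ⟨a, rfl⟩ := QuotPow.mk_surjective π (2 * r) x
  rw [projPow_mk, QuotPow.mk_eq_zero] at hx
  obtain ⟨b, rfl⟩ := hx
  exact ⟨_, inclPow_mk π r b⟩

lemma inclPow_injective [IsDomain O] [Module.Free O A] {π : O} (hπ : π ≠ 0) (r : ℕ) :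
    Function.Injective (inclPow (A := A) π r) := by
  rw [injective_iff_map_eq_zero]
  intro x hx
  obtain ⟨a, rfl⟩ := QuotPow.mk_surjective π r x
  rw [inclPow_mk, QuotPow.mk_eq_zero] at hx
  obtain ⟨b, hb⟩ := hx
  rw [two_mul, pow_add, ← smul_smul] at hb
  exact QuotPow.mk_eq_zero.2 ⟨b, smul_right_injective A (pow_ne_zero r hπ) hb⟩

variable (P : ProjectiveResolution (regular O A))

/-- The sequence of cochain complexes
`Hom_{Aᵉ}(P, A/π^r A) → Hom_{Aᵉ}(P, A/π^{2r} A) → Hom_{Aᵉ}(P, A/π^r A)`. -/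
def bocksteinSeq (π : O) (r : ℕ) : ShortComplex (CochainComplex (ModuleCat.{v} O) ℕ) :=
  ShortComplex.mk (homComplexMap P.complex (inclPow (A := A) π r))
    (homComplexMap P.complex (projPow (A := A) π r)) <| by
      ext n f : 3
      exact LinearMap.ext fun x => projPow_inclPow π r _

lemma bocksteinSeq_shortExact [IsDomain O] [Module.Free O A] {π : O} (hπ : π ≠ 0) (r : ℕ) :
    (bocksteinSeq P π r).ShortExact := by
  refine HomologicalComplex.shortExact_of_degreewise_shortExact _ fun n => ?_
  have hP : Module.Projective (Env O A) (P.complex.X n) := inferInstance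
  refine ShortComplex.ShortExact.mk' ?_ ?_ ?_
  · rw [ShortComplex.moduleCat_exact_iff]
    intro (f : P.complex.X n →ₗ[Env O A] QuotPow A π (2 * r)) hf
    have hf' : ∀ x, projPow π r (f x) = 0 := fun x =>
      LinearMap.congr_fun (hf : projPow π r ∘ₗ f = 0) x
    choose g hg using fun x => exists_inclPow π r (f x) (hf' x)
    refine ⟨({ toFun := g, map_add' := fun x y => ?_, map_smul' := fun e x => ?_ } :
      P.complex.X n →ₗ[Env O A] QuotPow A π r), LinearMap.ext hg⟩
    · exact inclPow_injective hπ r (by simp [hg])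
    · exact inclPow_injective hπ r (by simp [hg])
  · rw [ModuleCat.mono_iff_injective]
    intro f g hfg
    exact LinearMap.ext fun x => inclPow_injective hπ r
      (LinearMap.congr_fun (hfg : inclPow π r ∘ₗ f = inclPow π r ∘ₗ g) x)
  · rw [ModuleCat.epi_iff_surjective]
    intro (f : P.complex.X n →ₗ[Env O A] QuotPow A π r)
    exact Module.projective_lifting_property (projPow π r) f (projPow_surjective π r)

/-- The Hochschild cohomology `HH^n(A/π^r A) = HH^n(A; A/π^r A)`, computed as
`H^n(Hom_{Aᵉ}(P, A/π^r A))` with a projective resolution `P` of the bimodule `A`. If `A` is free over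
the domain `O`, the complex `P/π^r P` is a projective resolution of `A/π^r A` over its own enveloping
algebra and has the same cochain complex of homomorphisms to `A/π^r A`. -/
def HH (π : O) (r n : ℕ) : ModuleCat.{v} O :=
  (homComplex P.complex (QuotPow A π r)).homology n

/-- The Bockstein homomorphism `β_n : HH^n(A/π^r A) → HH^{n+1}(A/π^r A)`: the connecting homomorphism
of the short exact sequence of cochain complexes `bocksteinSeq`. -/
def bockstein [IsDomain O] [Module.Free O A] {π : O} (hπ : π ≠ 0) (r n : ℕ) :
    HH P π r n →ₗ[O] HH P π r (n + 1) :=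
  ((bocksteinSeq_shortExact P hπ r).δ n (n + 1) rfl).hom

variable {P} {π : O} {r : ℕ}

/-- The cohomology class of a cocycle `f : P_n → A/π^r A`. -/
def HH.cls {n : ℕ} (f : P.complex.X n →ₗ[Env O A] QuotPow A π r)
    (hf : f ∘ₗ dif P.complex (n + 1) n = 0) : HH P π r n :=
  (homComplex P.complex (QuotPow A π r)).homologyπ n
    ((homComplex P.complex (QuotPow A π r)).cyclesMk f (n + 1) (by simp) hf)

lemma HH.cls_surjective {n : ℕ} (ζ : HH P π r n) : ∃ f hf, HH.cls (n := n) f hf = ζ := by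
  obtain ⟨z, rfl⟩ := (ModuleCat.epi_iff_surjective
    ((homComplex P.complex (QuotPow A π r)).homologyπ n)).1 inferInstance ζ
  refine ⟨(homComplex P.complex (QuotPow A π r)).iCycles n z, ?_, ?_⟩
  · exact congrArg (fun φ => φ.hom z)
      ((homComplex P.complex (QuotPow A π r)).iCycles_d n (n + 1))
  · refine congrArg (fun z => (homComplex P.complex (QuotPow A π r)).homologyπ n z) ?_
    refine (ModuleCat.mono_iff_injective
      ((homComplex P.complex (QuotPow A π r)).iCycles n)).1 inferInstance ?_
    exact (homComplex P.complex (QuotPow A π r)).i_cyclesMk _ _ _ _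

lemma HH.cls_sub {n : ℕ} {f g : P.complex.X n →ₗ[Env O A] QuotPow A π r}
    (hf : f ∘ₗ dif P.complex (n + 1) n = 0) (hg : g ∘ₗ dif P.complex (n + 1) n = 0) :
    HH.cls f hf - HH.cls g hg = HH.cls (f - g) (by rw [LinearMap.sub_comp, hf, hg, sub_zero]) := by
  refine (map_sub ((homComplex P.complex (QuotPow A π r)).homologyπ n).hom _ _).symm.trans ?_
  refine congrArg (fun z => (homComplex P.complex (QuotPow A π r)).homologyπ n z) ?_
  refine (ModuleCat.mono_iff_injective
    ((homComplex P.complex (QuotPow A π r)).iCycles n)).1 inferInstance ?_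
  refine (map_sub ((homComplex P.complex (QuotPow A π r)).iCycles n).hom _ _).trans ?_
  refine (congrArg₂ (· - ·) ((homComplex P.complex (QuotPow A π r)).i_cyclesMk _ _ _ _)
    ((homComplex P.complex (QuotPow A π r)).i_cyclesMk _ _ _ _)).trans ?_
  exact ((homComplex P.complex (QuotPow A π r)).i_cyclesMk _ _ _ _).symm

lemma HH.cls_eq_zero {n : ℕ} {f : P.complex.X n →ₗ[Env O A] QuotPow A π r}
    (hf : f ∘ₗ dif P.complex (n + 1) n = 0) :
    HH.cls f hf = 0 ↔
      ∃ (i : ℕ) (u : P.complex.X i →ₗ[Env O A] QuotPow A π r), f = u ∘ₗ dif P.complex n i := by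
  set K := homComplex P.complex (QuotPow A π r) with hK
  constructor
  · intro h
    have hex := ShortComplex.exact_of_g_is_cokernel
      (ShortComplex.mk _ _ (K.toCycles_comp_homologyπ ((ComplexShape.up ℕ).prev n) n))
      (K.homologyIsCokernel _ n rfl)
    obtain ⟨u, hu⟩ := (ShortComplex.moduleCat_exact_iff _).1 hex _ h
    refine ⟨_, u, ?_⟩
    have h1 := congrArg (fun z => (K.iCycles n).hom z) hu
    have h2 := congrArg (fun φ => φ.hom u) (K.toCycles_i ((ComplexShape.up ℕ).prev n) n)
    exact ((K.i_cyclesMk _ _ _ _).symm.trans h1.symm).trans h2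
  · rintro ⟨i, u, rfl⟩
    have h2 := congrArg (fun φ => φ.hom u) (K.toCycles_i i n)
    have h3 := congrArg (fun φ => φ.hom u) (K.toCycles_comp_homologyπ i n)
    refine Eq.trans ?_ h3
    refine congrArg (fun z => K.homologyπ n z) ?_
    refine (ModuleCat.mono_iff_injective (K.iCycles n)).1 inferInstance ?_
    exact (K.i_cyclesMk _ _ _ _).trans h2.symm

lemma HH.cls_eq_iff {n : ℕ} {f g : P.complex.X n →ₗ[Env O A] QuotPow A π r}
    (hf : f ∘ₗ dif P.complex (n + 1) n = 0) (hg : g ∘ₗ dif P.complex (n + 1) n = 0) :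
    HH.cls f hf = HH.cls g hg ↔
      ∃ (i : ℕ) (u : P.complex.X i →ₗ[Env O A] QuotPow A π r), f - g = u ∘ₗ dif P.complex n i := by
  rw [← sub_eq_zero, HH.cls_sub, HH.cls_eq_zero]

/-- The product of cochains `(f ⊗ g) ∘ h`, in degree `k = m + n`. -/
def cupCochain (h : Diagonal P) {m n k : ℕ} (hk : m + n = k)
    (f : P.complex.X m →ₗ[Env O A] QuotPow A π r) (g : P.complex.X n →ₗ[Env O A] QuotPow A π r) :
    P.complex.X k →ₗ[Env O A] QuotPow A π r :=
  BalTensor.pair f g ∘ₗ h.comp hk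

lemma pair_mapHom {X Y X' Y' : ModuleCat.{v} (Env O A)} (f : X →ₗ[Env O A] X')
    (g : Y →ₗ[Env O A] Y') (f' : X' →ₗ[Env O A] QuotPow A π r) (g' : Y' →ₗ[Env O A] QuotPow A π r)
    (t : BalTensor X Y) :
    BalTensor.pair f' g' (BalTensor.mapHom f g t) = BalTensor.pair (f' ∘ₗ f) (g' ∘ₗ g) t := by
  rw [← LinearMap.comp_apply]
  congr 1
  exact BalTensor.envHom_ext fun x y => by simp

lemma cupCochain_d (h : Diagonal P) {m n k : ℕ} (hk : m + n = k)
    (f : P.complex.X m →ₗ[Env O A] QuotPow A π r) (g : P.complex.X n →ₗ[Env O A] QuotPow A π r) :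
    cupCochain h hk f g ∘ₗ dif P.complex (k + 1) k
      = cupCochain h (by omega) (f ∘ₗ dif P.complex (m + 1) m) g
        + (-1 : ℤ) ^ m • cupCochain h (by omega) f (g ∘ₗ dif P.complex (n + 1) n) := by
  refine LinearMap.ext fun x => ?_
  change BalTensor.pair f g (h.comp hk (dif P.complex (k + 1) k x)) = _
  rw [← h.comm, map_add, map_zsmul, pair_mapHom, pair_mapHom]
  rfl


lemma pair_add_left {X Y : ModuleCat.{v} (Env O A)} (f f' : X →ₗ[Env O A] QuotPow A π r)
    (g : Y →ₗ[Env O A] QuotPow A π r) :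
    BalTensor.pair (f + f') g = BalTensor.pair f g + BalTensor.pair f' g :=
  BalTensor.envHom_ext fun x y => by simp [add_mul]

lemma pair_add_right {X Y : ModuleCat.{v} (Env O A)} (f : X →ₗ[Env O A] QuotPow A π r)
    (g g' : Y →ₗ[Env O A] QuotPow A π r) :
    BalTensor.pair f (g + g') = BalTensor.pair f g + BalTensor.pair f g' :=
  BalTensor.envHom_ext fun x y => by simp [mul_add]

lemma cupCochain_add_left (h : Diagonal P) {m n k : ℕ} (hk : m + n = k)
    (f f' : P.complex.X m →ₗ[Env O A] QuotPow A π r)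
    (g : P.complex.X n →ₗ[Env O A] QuotPow A π r) :
    cupCochain h hk (f + f') g = cupCochain h hk f g + cupCochain h hk f' g := by
  rw [cupCochain, pair_add_left, LinearMap.add_comp]; rfl

lemma cupCochain_add_right (h : Diagonal P) {m n k : ℕ} (hk : m + n = k)
    (f : P.complex.X m →ₗ[Env O A] QuotPow A π r)
    (g g' : P.complex.X n →ₗ[Env O A] QuotPow A π r) :
    cupCochain h hk f (g + g') = cupCochain h hk f g + cupCochain h hk f g' := by
  rw [cupCochain, pair_add_right, LinearMap.add_comp]; rfl

lemma cupCochain_zero_left (h : Diagonal P) {m n k : ℕ} (hk : m + n = k)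
    (g : P.complex.X n →ₗ[Env O A] QuotPow A π r) :
    cupCochain h hk (0 : P.complex.X m →ₗ[Env O A] QuotPow A π r) g = 0 := by
  have := cupCochain_add_left h hk (0 : P.complex.X m →ₗ[Env O A] QuotPow A π r) 0 g
  simpa using this

lemma cupCochain_zero_right (h : Diagonal P) {m n k : ℕ} (hk : m + n = k)
    (f : P.complex.X m →ₗ[Env O A] QuotPow A π r) :
    cupCochain h hk f (0 : P.complex.X n →ₗ[Env O A] QuotPow A π r) = 0 := by
  have := cupCochain_add_right h hk f (0 : P.complex.X n →ₗ[Env O A] QuotPow A π r) 0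
  simpa using this

lemma cupCochain_cocycle (h : Diagonal P) {m n k : ℕ} (hk : m + n = k)
    {f : P.complex.X m →ₗ[Env O A] QuotPow A π r} {g : P.complex.X n →ₗ[Env O A] QuotPow A π r}
    (hf : f ∘ₗ dif P.complex (m + 1) m = 0) (hg : g ∘ₗ dif P.complex (n + 1) n = 0) :
    cupCochain h hk f g ∘ₗ dif P.complex (k + 1) k = 0 := by
  rw [cupCochain_d, hf, hg, cupCochain_zero_left, cupCochain_zero_right, smul_zero, add_zero]

/-- The cup product `HH^m(A/π^r A) × HH^n(A/π^r A) → HH^k(A/π^r A)`, `k = m + n`, which sends the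
classes of the cocycles `f` and `g` to the class of `(f ⊗ g) ∘ h`; see `cup_cls`. -/
def cup (h : Diagonal P) {m n k : ℕ} (hk : m + n = k) (ζ : HH P π r m) (η : HH P π r n) :
    HH P π r k :=
  HH.cls (cupCochain h hk (HH.cls_surjective ζ).choose (HH.cls_surjective η).choose)
    (cupCochain_cocycle h hk (HH.cls_surjective ζ).choose_spec.choose
      (HH.cls_surjective η).choose_spec.choose)

lemma exists_cup_sub_left (h : Diagonal P) {m n k : ℕ} (hk : m + n = k) {i : ℕ}
    (u : P.complex.X i →ₗ[Env O A] QuotPow A π r) {g : P.complex.X n →ₗ[Env O A] QuotPow A π r}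
    (hg : g ∘ₗ dif P.complex (n + 1) n = 0) :
    ∃ (l : ℕ) (w : P.complex.X l →ₗ[Env O A] QuotPow A π r),
      cupCochain h hk (u ∘ₗ dif P.complex m i) g = w ∘ₗ dif P.complex k l := by
  by_cases hi : i + 1 = m
  · subst hi
    obtain rfl : k = i + n + 1 := by omega
    refine ⟨i + n, cupCochain h rfl u g, ?_⟩
    rw [cupCochain_d, hg, cupCochain_zero_right, smul_zero, add_zero]
  · have h0 : dif P.complex m i = 0 := by rw [dif, P.complex.shape m i hi]; rfl
    refine ⟨0, 0, ?_⟩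
    rw [h0, LinearMap.comp_zero, LinearMap.zero_comp, cupCochain_zero_left]

lemma exists_cup_sub_right (h : Diagonal P) {m n k : ℕ} (hk : m + n = k) {i : ℕ}
    (u : P.complex.X i →ₗ[Env O A] QuotPow A π r) {f : P.complex.X m →ₗ[Env O A] QuotPow A π r}
    (hf : f ∘ₗ dif P.complex (m + 1) m = 0) :
    ∃ (l : ℕ) (w : P.complex.X l →ₗ[Env O A] QuotPow A π r),
      cupCochain h hk f (u ∘ₗ dif P.complex n i) = w ∘ₗ dif P.complex k l := by
  by_cases hi : i + 1 = n
  · subst hi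
    obtain rfl : k = m + i + 1 := by omega
    refine ⟨m + i, (-1 : ℤ) ^ m • cupCochain h rfl f u, ?_⟩
    rw [LinearMap.smul_comp, cupCochain_d, hf, cupCochain_zero_left, zero_add, smul_smul,
      ← mul_pow, neg_one_mul, neg_neg, one_pow, one_smul]
  · have h0 : dif P.complex n i = 0 := by rw [dif, P.complex.shape n i hi]; rfl
    refine ⟨0, 0, ?_⟩
    rw [h0, LinearMap.comp_zero, LinearMap.zero_comp, cupCochain_zero_right]

/-- The cup product is induced by the product of cocycles, whatever the representatives. -/
lemma cup_cls (h : Diagonal P) {m n k : ℕ} (hk : m + n = k)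
    {f : P.complex.X m →ₗ[Env O A] QuotPow A π r} {g : P.complex.X n →ₗ[Env O A] QuotPow A π r}
    (hf : f ∘ₗ dif P.complex (m + 1) m = 0) (hg : g ∘ₗ dif P.complex (n + 1) n = 0) :
    cup h hk (HH.cls f hf) (HH.cls g hg)
      = HH.cls (cupCochain h hk f g) (cupCochain_cocycle h hk hf hg) := by
  have key : ∀ (f' : P.complex.X m →ₗ[Env O A] QuotPow A π r)
      (hf' : f' ∘ₗ dif P.complex (m + 1) m = 0) (g' : P.complex.X n →ₗ[Env O A] QuotPow A π r)
      (hg' : g' ∘ₗ dif P.complex (n + 1) n = 0), HH.cls f' hf' = HH.cls f hf →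
      HH.cls g' hg' = HH.cls g hg →
      HH.cls (cupCochain h hk f' g') (cupCochain_cocycle h hk hf' hg')
        = HH.cls (cupCochain h hk f g) (cupCochain_cocycle h hk hf hg) := by
    intro f' hf' g' hg' h1 h2
    obtain ⟨i, u, hu⟩ := (HH.cls_eq_iff _ _).1 h1
    obtain ⟨j, w, hw⟩ := (HH.cls_eq_iff _ _).1 h2
    refine Eq.trans (b := HH.cls (cupCochain h hk f g') (cupCochain_cocycle h hk hf hg')) ?_ ?_
    · rw [HH.cls_eq_iff]
      obtain ⟨l, z, hz⟩ := exists_cup_sub_left h hk u hg'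
      refine ⟨l, z, ?_⟩
      rw [← hz, ← hu, sub_eq_iff_eq_add, ← cupCochain_add_left, sub_add_cancel]
    · rw [HH.cls_eq_iff]
      obtain ⟨l, z, hz⟩ := exists_cup_sub_right h hk w hf
      refine ⟨l, z, ?_⟩
      rw [← hz, ← hw, sub_eq_iff_eq_add, ← cupCochain_add_right, sub_add_cancel]
  exact key _ _ _ _ (HH.cls_surjective (HH.cls f hf)).choose_spec.choose_spec
    (HH.cls_surjective (HH.cls g hg)).choose_spec.choose_spec

end Bockstein

end HochschildBockstein

end

open HochschildBockstein

/-!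
Represent `ζ` and `η` by cocycles `f` and `g` with values in `A / π^r A`, and lift them to cochains
`F` and `G` with values in `A / π^{2r} A`; this is possible because each `P_n` is projective. The
coboundaries of `F` and `G` vanish modulo `π^r`, so they are `π^r f'` and `π^r g'` for cocycles `f'`
and `g'`, and these represent the Bocksteins of `ζ` and `η` (`exists_lift_of_cocycle`,
`bockstein_cls`).

The cup product of cochains is defined for coefficients in `A / π^{2r} A` as well, and `F ⌣ G` lifts
`f ⌣ g`. The Leibniz rule for cochains computes its coboundary as
`(π^r f') ⌣ G + (-1)^m F ⌣ (π^r g')`. Multiplication by `π^r` is `A`-bilinear, in the sense that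
`π^r x * y = π^r (x * ȳ)` with `ȳ` the reduction of `y` (`inclPow_mul`, `mul_inclPow`), so this
coboundary is `π^r` times `f' ⌣ g + (-1)^m f ⌣ g'`. Hence the latter cocycle represents the Bockstein
of `ζη`.
-/

namespace HochschildBockstein

variable {O : Type u} {A : Type v} [CommRing O] [Ring A] [Algebra O A]
variable {P : ProjectiveResolution (regular O A)} {π : O} {r : ℕ}

/-! ### Cup products and the coefficient sequence -/

lemma QuotPow.mk_mul (s : ℕ) (a b : A) :
    QuotPow.mk π s (a * b) = QuotPow.mk π s a * QuotPow.mk π s b :=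
  map_mul (Ideal.Quotient.mkₐ O (powIdeal A π s)) a b

lemma projPow_mul (x y : QuotPow A π (2 * r)) :
    projPow π r (x * y) = projPow π r x * projPow π r y := by
  obtain ⟨a, rfl⟩ := QuotPow.mk_surjective π _ x
  obtain ⟨b, rfl⟩ := QuotPow.mk_surjective π _ y
  rw [← QuotPow.mk_mul, projPow_mk, projPow_mk, projPow_mk, QuotPow.mk_mul]

lemma inclPow_mul (x : QuotPow A π r) (y : QuotPow A π (2 * r)) :
    inclPow π r x * y = inclPow π r (x * projPow π r y) := by
  obtain ⟨a, rfl⟩ := QuotPow.mk_surjective π _ x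
  obtain ⟨b, rfl⟩ := QuotPow.mk_surjective π _ y
  rw [projPow_mk, ← QuotPow.mk_mul, inclPow_mk, inclPow_mk, ← QuotPow.mk_mul, smul_mul_assoc]

lemma mul_inclPow (x : QuotPow A π (2 * r)) (y : QuotPow A π r) :
    x * inclPow π r y = inclPow π r (projPow π r x * y) := by
  obtain ⟨a, rfl⟩ := QuotPow.mk_surjective π _ x
  obtain ⟨b, rfl⟩ := QuotPow.mk_surjective π _ y
  rw [projPow_mk, ← QuotPow.mk_mul, inclPow_mk, inclPow_mk, ← QuotPow.mk_mul, mul_smul_comm]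

variable (h : Diagonal P) {m n k : ℕ} (hk : m + n = k)

lemma projPow_comp_cupCochain (F : P.complex.X m →ₗ[Env O A] QuotPow A π (2 * r))
    (G : P.complex.X n →ₗ[Env O A] QuotPow A π (2 * r)) :
    projPow π r ∘ₗ cupCochain h hk F G
      = cupCochain h hk (projPow π r ∘ₗ F) (projPow π r ∘ₗ G) := by
  rw [cupCochain, cupCochain, ← LinearMap.comp_assoc]
  congr 1
  exact BalTensor.envHom_ext fun x y => by simp [projPow_mul]

lemma cupCochain_inclPow_comp (f : P.complex.X m →ₗ[Env O A] QuotPow A π r)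
    (G : P.complex.X n →ₗ[Env O A] QuotPow A π (2 * r)) :
    cupCochain h hk (inclPow π r ∘ₗ f) G
      = inclPow π r ∘ₗ cupCochain h hk f (projPow π r ∘ₗ G) := by
  rw [cupCochain, cupCochain, ← LinearMap.comp_assoc]
  congr 1
  exact BalTensor.envHom_ext fun x y => by simp [inclPow_mul]

lemma cupCochain_comp_inclPow (F : P.complex.X m →ₗ[Env O A] QuotPow A π (2 * r))
    (g : P.complex.X n →ₗ[Env O A] QuotPow A π r) :
    cupCochain h hk F (inclPow π r ∘ₗ g)
      = inclPow π r ∘ₗ cupCochain h hk (projPow π r ∘ₗ F) g := by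
  rw [cupCochain, cupCochain, ← LinearMap.comp_assoc]
  congr 1
  exact BalTensor.envHom_ext fun x y => by simp [mul_inclPow]

lemma HH.cls_add_neg_one_pow_smul (e : ℕ) {f g q : P.complex.X n →ₗ[Env O A] QuotPow A π r}
    (hf : f ∘ₗ dif P.complex (n + 1) n = 0) (hg : g ∘ₗ dif P.complex (n + 1) n = 0)
    (hq : q ∘ₗ dif P.complex (n + 1) n = 0) (hfgq : q = f + (-1 : ℤ) ^ e • g) :
    HH.cls q hq = HH.cls f hf + (-1 : ℤ) ^ e • HH.cls g hg := by
  rcases neg_one_pow_eq_or ℤ e with he | he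
  · rw [he, one_smul] at hfgq ⊢
    subst hfgq
    rw [← sub_eq_iff_eq_add, HH.cls_sub]
    congr 1
    exact add_sub_cancel_right f g
  · rw [he, neg_one_smul, ← sub_eq_add_neg] at hfgq ⊢
    subst hfgq
    exact (HH.cls_sub hf hg).symm

/-! ### The Bockstein on cocycles -/

variable [IsDomain O] [Module.Free O A]

/-- A cochain `f'` with `π^r f'` a coboundary is a cocycle, as `π^r` is injective on cochains. -/
lemma cocycle_of_inclPow_comp_eq (hπ : π ≠ 0)
    {F : P.complex.X n →ₗ[Env O A] QuotPow A π (2 * r)}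
    {f' : P.complex.X (n + 1) →ₗ[Env O A] QuotPow A π r}
    (hF : inclPow π r ∘ₗ f' = F ∘ₗ dif P.complex (n + 1) n) :
    f' ∘ₗ dif P.complex (n + 2) (n + 1) = 0 := by
  refine LinearMap.ext fun x => inclPow_injective hπ r ?_
  refine (LinearMap.congr_fun hF (dif P.complex (n + 2) (n + 1) x)).trans ?_
  rw [LinearMap.comp_apply, dif_dif, map_zero, LinearMap.zero_apply, map_zero]

/-- The Bockstein of the class of `f` is computed by any lift `F` of `f`: it is the class of the
cochain `f'` with `π^r f' = F ∘ d`. -/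
lemma bockstein_cls (hπ : π ≠ 0) {f : P.complex.X n →ₗ[Env O A] QuotPow A π r}
    (hf : f ∘ₗ dif P.complex (n + 1) n = 0)
    (F : P.complex.X n →ₗ[Env O A] QuotPow A π (2 * r)) (hFf : projPow π r ∘ₗ F = f)
    {f' : P.complex.X (n + 1) →ₗ[Env O A] QuotPow A π r}
    (hF : inclPow π r ∘ₗ f' = F ∘ₗ dif P.complex (n + 1) n) :
    bockstein P hπ r n (HH.cls f hf) = HH.cls f' (cocycle_of_inclPow_comp_eq hπ hF) :=
  (bocksteinSeq_shortExact P hπ r).δ_apply n (n + 1) rfl f hf F hFf f' hF (n + 2) (by simp)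

lemma exists_lift_of_cocycle (hπ : π ≠ 0) {f : P.complex.X n →ₗ[Env O A] QuotPow A π r}
    (hf : f ∘ₗ dif P.complex (n + 1) n = 0) :
    ∃ (F : P.complex.X n →ₗ[Env O A] QuotPow A π (2 * r))
      (f' : P.complex.X (n + 1) →ₗ[Env O A] QuotPow A π r),
      projPow π r ∘ₗ F = f ∧ inclPow π r ∘ₗ f' = F ∘ₗ dif P.complex (n + 1) n := by
  have hP : Module.Projective (Env O A) (P.complex.X n) := inferInstance
  obtain ⟨F, hF⟩ := Module.projective_lifting_property (projPow π r) f (projPow_surjective π r)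
  have hex := ((bocksteinSeq_shortExact P hπ r).map_of_exact
    (HomologicalComplex.eval (ModuleCat.{v} O) (ComplexShape.up ℕ) (n + 1))).exact
  obtain ⟨f', hf'⟩ := (ShortComplex.moduleCat_exact_iff _).1 hex
    (F ∘ₗ dif P.complex (n + 1) n : P.complex.X (n + 1) →ₗ[Env O A] QuotPow A π (2 * r))
    (by
      change projPow π r ∘ₗ (F ∘ₗ dif P.complex (n + 1) n) = 0
      rw [← LinearMap.comp_assoc, hF, hf])
  exact ⟨F, f', hF, hf'⟩

end HochschildBockstein

theorem proposition4p3 {O : Type u} [CommRing O] [IsDomain O] [IsDiscreteValuationRing O]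
    [IsAdicComplete (IsLocalRing.maximalIdeal O) O]
    (π : O) (hπ0 : π ≠ 0) (hπ : IsLocalRing.maximalIdeal O = Ideal.span {π})
    {A : Type v} [Ring A] [Algebra O A] [Module.Free O A] [Module.Finite O A]
    (r : ℕ) (hr : 0 < r)
    (P : ProjectiveResolution (regular O A)) (h : Diagonal P)
    (m n : ℕ) (ζ : HH P π r m) (η : HH P π r n) :
    bockstein P hπ0 r (m + n) (cup h rfl ζ η)
      = cup h (Nat.add_right_comm m 1 n) (bockstein P hπ0 r m ζ) η
        + (-1 : ℤ) ^ m • cup h rfl ζ (bockstein P hπ0 r n η) := by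
  obtain ⟨f, hf, rfl⟩ := HH.cls_surjective ζ
  obtain ⟨g, hg, rfl⟩ := HH.cls_surjective η
  obtain ⟨F, f', hFf, hF⟩ := exists_lift_of_cocycle hπ0 hf
  obtain ⟨G, g', hGg, hG⟩ := exists_lift_of_cocycle hπ0 hg
  have hFG : inclPow π r ∘ₗ (cupCochain h (Nat.add_right_comm m 1 n) f' g
        + (-1 : ℤ) ^ m • cupCochain h rfl f g')
      = cupCochain h rfl F G ∘ₗ dif P.complex (m + n + 1) (m + n) := by
    rw [cupCochain_d, ← hF, ← hG, cupCochain_inclPow_comp, cupCochain_comp_inclPow, hFf, hGg]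
    exact LinearMap.ext fun x => (map_add (inclPow π r) _ _).trans
      (congrArg _ (map_zsmul (inclPow π r) _ _))
  rw [bockstein_cls hπ0 hf F hFf hF, bockstein_cls hπ0 hg G hGg hG, cup_cls, cup_cls, cup_cls,
    bockstein_cls hπ0 _ (cupCochain h rfl F G)
      (by rw [projPow_comp_cupCochain, hFf, hGg]) hFG]
  exact HH.cls_add_neg_one_pow_smul m _ _ _ rfl
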